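/- Let $(X,\mu)$ be a finite measure space. Let $K:\mathbb R\times X\to[0,\infty)$ be integrable on $\mathbb R\times X$ with $\int_{\mathbb R}K(s,\tau)\,ds>0$ for every $\tau\in X$. Let $g:[0,\infty)\times X\to[0,\infty)$ be measurable, continuous in its first variable for each fixed $\tau$, with $g(0,\tau)=0$ and such that the right derivative $g'(0,\tau)$ exists and is positive for every $\tau$. Consider the equation $$\phi(t)=\int_X d\mu(\tau)\int_{\mathbb R}K(s,\tau)\,g(\phi(t-s),\tau)\,ds,\qquad t\in\mathbb R, \tag{1}$$ and put $\chi(z)=1-\int_X\int_{\mathbb R}K(s,\tau)g'(0,\tau)e^{-sz}\,ds\,d\mu(\tau)$. Assume $\chi(0)<0$ together with the following conditions. **(C)** For each $\delta>0$ there is a measurable $C_\delta:X\to[0,\infty)$ with $g(u,\tau)\le C_\delta(\tau)u$ for all $u\in[0,\delta]$, $\tau\in X$, and $\int_X C_\delta(\tau)\,d\mu(\tau)\int_{\mathbb R}K(s,\tau)\,ds<\infty$. **(P)** A bounded solution $\phi\ge 0$ of (1) that vanishes at some point is identically zero. **(N)** There is a point $\tau_0\in X$ (with $\{\tau_0\}$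 measurable) such that $\mu(\{\tau_0\})=1$, the function $v\mapsto g(v,\tau)$ is nondecreasing on $[0,\infty)$ for each $\tau\ne\tau_0$, and $g(v,\tau_0)>0$ for $v>0$. Moreover, with $$\tilde g(v)=\int_{X\setminus\{\tau_0\}}g(v,\tau)\,d\mu(\tau)\int_{\mathbb R}K(s,\tau)\,ds,\qquad \Theta(v)=v-\tilde g(v),\qquad C=\int_{\mathbb R}K(s,\tau_0)\,ds,$$ there is $\zeta_2>0$ such that $\Theta$ is strictly increasing on $[0,\zeta_2]$, $g(\cdot,\tau_0)$ is bounded and $\Theta(\zeta_2)>C\sup_{v\ge0}g(v,\tau_0)$. Set $G(v)=\Theta^{-1}(C\,g(v,\tau_0))$, $v\ge0$, where $\Theta^{-1}$ is the inverse of $\Theta|_{[0,\zeta_2]}$. Call $\zeta_1\in(0,\zeta_2)$ admissible if $G([\zeta_1,\zeta_2])\subseteq[\zeta_1,\zeta_2]$, $G([0,\infty))\subseteq[0,\zeta_2]$, $\min_{[\zeta_1,\zeta_2]}G=G(\zeta_1)$, and $G(s)>s$ for all $s\in(0,\zeta_1]$. Then an admissible $\zeta_1$ exists. Moreover, for every admissible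 $\zeta_1$ (which thus does not depend on $\phi$) the following holds. Let $\phi$ be a positive bounded solution of (1) such that $\Theta$ is strictly increasing on $[0,\sup_{\mathbb R}\phi]$ (this holds automatically if $\sup\phi\le\zeta_2$, or if $\Theta$ is strictly increasing on $[0,\infty)$). If $\inf_{s\in\mathbb R}\phi(s)<\zeta_1$, then for some $\omega\in\{-\infty,+\infty\}$ $$\lim_{t\to\omega}\phi(t)=0\qquad\text{and}\qquad \liminf_{t\to-\omega}\phi(t)>\zeta_1 .$$ -/

import Mathlib

open MeasureTheory Set Filter Topology

noncomputable section

namespace ConvEq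

variable {X : Type*} [MeasurableSpace X]

/-- The right derivative `g'(0, τ)` of `v ↦ g(v, τ)` at `0`. -/
def gPrime (g : ℝ → X → ℝ) (τ : X) : ℝ :=
  derivWithin (fun v => g v τ) (Ici 0) 0

/-- The kernel `K ≥ 0` is integrable on `ℝ × X`, with `∫ K(s, τ) ds > 0` for all `τ`. -/
structure IsKernel (μ : Measure X) (K : ℝ → X → ℝ) : Prop where
  nonneg : ∀ s τ, 0 ≤ K s τ
  integrable : Integrable (fun p : ℝ × X => K p.1 p.2) (volume.prod μ)
  pos : ∀ τ, 0 < ∫⁻ s, ENNReal.ofReal (K s τ)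

/-- The nonlinearity `g : ℝ₊ × X → ℝ₊` (only its values at `v ≥ 0` matter): measurable, continuous
in `v`, with `g(0, τ) = 0` and an existing derivative `g'(0, τ) > 0`. -/
structure IsNonlinearity (g : ℝ → X → ℝ) : Prop where
  nonneg : ∀ v, 0 ≤ v → ∀ τ, 0 ≤ g v τ
  measurable : Measurable (fun p : NNReal × X => g p.1 p.2)
  zero : ∀ τ, g 0 τ = 0
  continuousOn : ∀ τ, ContinuousOn (fun v => g v τ) (Ici 0)
  differentiable : ∀ τ, DifferentiableWithinAt ℝ (fun v => g v τ) (Ici 0) 0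
  gPrime_pos : ∀ τ, 0 < gPrime g τ

/-- The characteristic function
`χ(z) = 1 - ∫_X ∫_ℝ K(s, τ) g'(0, τ) e^{-sz} ds dμ(τ)`. If the integral at `z` diverges,
the value here is `1`, so `χ(z) < 0` includes convergence. -/
def chi (μ : Measure X) (K g : ℝ → X → ℝ) (z : ℝ) : ℝ :=
  1 - ∫ p : ℝ × X, K p.1 p.2 * gPrime g p.2 * Real.exp (-p.1 * z) ∂(volume.prod μ)

/-- `φ : ℝ → [0, ∞)` solves `φ(t) = ∫_X dμ(τ) ∫_ℝ K(s, τ) g(φ(t - s), τ) ds` for all `t`,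
the integral being absolutely convergent. -/
structure IsSolution (μ : Measure X) (K g : ℝ → X → ℝ) (φ : ℝ → ℝ) : Prop where
  nonneg : ∀ t, 0 ≤ φ t
  aemeasurable : AEMeasurable φ volume
  integrable : ∀ t, Integrable (fun p : ℝ × X => K p.1 p.2 * g (φ (t - p.1)) p.2) (volume.prod μ)
  eq : ∀ t, φ t = ∫ τ, (∫ s, K s τ * g (φ (t - s)) τ) ∂μ

/-- Condition (C). -/
def CondC (μ : Measure X) (K g : ℝ → X → ℝ) : Prop :=
  ∀ δ : ℝ, 0 < δ → ∃ Cδ : X → ℝ, Measurable Cδ ∧ (∀ τ, 0 ≤ Cδ τ) ∧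
    (∀ τ, ∀ u ∈ Icc 0 δ, g u τ ≤ Cδ τ * u) ∧
    Integrable (fun τ => Cδ τ * ∫ s, K s τ) μ

/-- Condition (P): a bounded nonnegative solution that vanishes at some point is zero. -/
def CondP (μ : Measure X) (K g : ℝ → X → ℝ) : Prop :=
  ∀ φ : ℝ → ℝ, IsSolution μ K g φ → BddAbove (range φ) → (∃ t₀, φ t₀ = 0) → ∀ t, φ t = 0

/-- `g̃(v) = ∫_{X ∖ {τ₀}} g(v, τ) dμ(τ) ∫_ℝ K(s, τ) ds`. -/
def gTilde (μ : Measure X) (K g : ℝ → X → ℝ) (τ₀ : X) (v : ℝ) : ℝ :=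
  ∫ τ in {τ₀}ᶜ, g v τ * (∫ s, K s τ) ∂μ

/-- `Θ(v) = v - g̃(v)`. -/
def Theta (μ : Measure X) (K g : ℝ → X → ℝ) (τ₀ : X) (v : ℝ) : ℝ :=
  v - gTilde μ K g τ₀ v

/-- Condition (N), for the point `τ₀` and the number `ζ₂`. -/
structure CondN (μ : Measure X) (K g : ℝ → X → ℝ) (τ₀ : X) (ζ₂ : ℝ) : Prop where
  measurableSet_singleton : MeasurableSet ({τ₀} : Set X)
  mass_one : μ {τ₀} = 1
  mono : ∀ τ, τ ≠ τ₀ → MonotoneOn (fun v => g v τ) (Ici 0)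
  pos : ∀ v, 0 < v → 0 < g v τ₀
  zeta_pos : 0 < ζ₂
  theta_strictMono : StrictMonoOn (Theta μ K g τ₀) (Icc 0 ζ₂)
  bdd : BddAbove ((fun v => g v τ₀) '' Ici 0)
  theta_gt : (∫ s, K s τ₀) * sSup ((fun v => g v τ₀) '' Ici 0) < Theta μ K g τ₀ ζ₂

/-- `G(v) = Θ⁻¹(C g(v, τ₀))`, where `C = ∫_ℝ K(s, τ₀) ds` and `Θ⁻¹` is the inverse of `Θ` restricted
to `[0, ζ₂]`. -/
def G (μ : Measure X) (K g : ℝ → X → ℝ) (τ₀ : X) (ζ₂ v : ℝ) : ℝ :=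
  Function.invFunOn (Theta μ K g τ₀) (Icc 0 ζ₂) ((∫ s, K s τ₀) * g v τ₀)

/-- The properties that characterise the admissible choices of `ζ₁`. -/
structure IsZeta1 (μ : Measure X) (K g : ℝ → X → ℝ) (τ₀ : X) (ζ₂ ζ₁ : ℝ) : Prop where
  pos : 0 < ζ₁
  lt : ζ₁ < ζ₂
  mapsTo : MapsTo (G μ K g τ₀ ζ₂) (Icc ζ₁ ζ₂) (Icc ζ₁ ζ₂)
  mapsTo_all : MapsTo (G μ K g τ₀ ζ₂) (Ici 0) (Icc 0 ζ₂)
  min_eq : IsMinOn (G μ K g τ₀ ζ₂) (Icc ζ₁ ζ₂) ζ₁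
  gt_self : ∀ s ∈ Ioc 0 ζ₁, s < G μ K g τ₀ ζ₂ s

end ConvEq

end

/-!
The proof rests on three facts about a positive bounded solution `φ`.

*Small values propagate.* Bounded solutions are uniformly continuous, and pointwise limits of their
translates are again solutions. Condition (P) therefore shows that `φ` is small on a long interval
around every point at which it is very small (`IsSolution.exists_small_near`). As `χ(0) < 0`, the
integral operator dominates, on functions small on `[-N, N]`, the integration against a kernel `k`
on `[-N, N]` with `∫ k > 1` (`exists_minorant`). Hence `φ` has no very small local minimum: it is
never very small between two points at which it is not small
(`IsSolution.exists_small_imp_or`). So if `inf φ = 0`, then `φ` vanishes at one of the ends `±∞`,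
and at either end a zero lower limit is a limit.

*No vanishing at both ends.* Near an end where it vanishes, `φ` satisfies `φ ≥ k * φ`. At `-∞` this
makes `F(t) = ∫_{-∞}^t φ` finite, with `F ≥ k * F`; integrating once more, the monotonicity of `F`
gives `(∫ k - 1) ∫_{-∞}^T F ≤ F(T) ∫ s k(s) ds`, so that the first moment of `k` is positive
(`first_moment_pos_of_supersolution`). At `+∞` the same argument makes it negative.

*Values below `ζ₁` are not bounded away from zero.* A solution with values in `[0, ζ₂]` does not
attain a positive minimum `m ≤ ζ₁`, since this would give `m ≥ G(x)` for some `x ∈ [m, ζ₂]`, where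
`G > m` (`CondN.not_attains_min`). By passing to limits of translates, a positive infimum, or a
positive lower limit at an end, exceeds `ζ₁` (`CondN.lt_ciInf`, `CondN.lt_liminf`).
-/

/-! ### Continuity of translation in `L¹` -/

theorem tendsto_integral_translate_sub {f : ℝ → ℝ} (hf : Integrable f) :
    Tendsto (fun h : ℝ => ∫ s, |f (s + h) - f s|) (𝓝 0) (𝓝 0) := by
  have hcont : Continuous fun h : ℝ => (ContinuousMap.mk (fun s : ℝ => s + h) : C(ℝ, ℝ)) :=
    ContinuousMap.continuous_of_continuous_uncurry _
      (show Continuous fun p : ℝ × ℝ => p.2 + p.1 by fun_prop)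
  have hpres : ∀ h : ℝ, MeasurePreserving (ContinuousMap.mk (fun s : ℝ => s + h) : C(ℝ, ℝ))
      volume volume := fun h => measurePreserving_add_right volume h
  have key : Tendsto (fun h : ℝ => Lp.compMeasurePreserving _ (hpres h) (hf.toL1 f)) (𝓝 0)
      (𝓝 (Lp.compMeasurePreserving _ (hpres 0) (hf.toL1 f))) :=
    Filter.Tendsto.compMeasurePreservingLp tendsto_const_nhds (hcont.tendsto 0) hpres (hpres 0)
      ENNReal.one_ne_top
  rw [tendsto_iff_norm_sub_tendsto_zero] at key
  refine key.congr fun h => ?_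
  rw [L1.norm_eq_integral_norm]
  refine integral_congr_ae ?_
  have h1 := Lp.coeFn_sub (Lp.compMeasurePreserving _ (hpres h) (hf.toL1 f))
    (Lp.compMeasurePreserving _ (hpres 0) (hf.toL1 f))
  have h2 := fun h => Lp.coeFn_compMeasurePreserving (hf.toL1 f) (hpres h)
  have h3 := fun h => (hpres h).quasiMeasurePreserving.ae_eq_comp hf.coeFn_toL1
  filter_upwards [h1, h2 h, h2 0, h3 h, h3 0] with s e1 e2 e3 e4 e5
  rw [e1, Pi.sub_apply, e2, e3, e4, e5]
  simp [Real.norm_eq_abs]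

namespace ConvEq

variable {X : Type*} [MeasurableSpace X] {μ : Measure X} {K g : ℝ → X → ℝ}

/-! ### The integral operator -/

theorem IsNonlinearity.aemeasurable_comp (hg : IsNonlinearity g) {u : ℝ → ℝ}
    (hu : AEMeasurable u) (hu0 : ∀ s, 0 ≤ u s) :
    AEMeasurable (fun p : ℝ × X => g (u p.1) p.2) (volume.prod μ) := by
  have h1 : AEMeasurable (fun p : ℝ × X => u p.1) (volume.prod μ) :=
    hu.comp_quasiMeasurePreserving Measure.quasiMeasurePreserving_fst
  have h2 := hg.measurable.comp_aemeasurable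
    (h1.real_toNNReal.prodMk (measurable_snd.aemeasurable))
  refine h2.congr (Eventually.of_forall fun p => ?_)
  simp [Function.comp, hu0]

theorem IsNonlinearity.measurable_apply (hg : IsNonlinearity g) {v : ℝ} (hv : 0 ≤ v) :
    Measurable (g v) := by
  have := hg.measurable.comp (measurable_prodMk_left (x := v.toNNReal))
  simpa [Function.comp_def, hv] using this

theorem IsSolution.aemeasurable_sub {φ : ℝ → ℝ} (hφ : IsSolution μ K g φ) (t : ℝ) :
    AEMeasurable fun s => φ (t - s) :=
  hφ.aemeasurable.comp_quasiMeasurePreserving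
    (Measure.measurePreserving_sub_left volume t).quasiMeasurePreserving

variable [IsFiniteMeasure μ]

/-- Condition (C) provides a dominating function on the product space `ℝ × X`. -/
theorem CondC.exists_bound (hC : CondC μ K g) (hK : IsKernel μ K) {δ : ℝ} (hδ : 0 < δ) :
    ∃ C : X → ℝ, Measurable C ∧ (∀ τ, 0 ≤ C τ) ∧ (∀ τ, ∀ u ∈ Icc 0 δ, g u τ ≤ C τ * u) ∧
      Integrable (fun p : ℝ × X => K p.1 p.2 * C p.2) (volume.prod μ) ∧
      Integrable (fun τ => C τ * ∫ s, K s τ) μ := by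
  obtain ⟨C, hm, h0, hb, hi⟩ := hC δ hδ
  refine ⟨C, hm, h0, hb, ?_, hi⟩
  rw [integrable_prod_iff']
  · refine ⟨?_, ?_⟩
    · filter_upwards [hK.integrable.prod_left_ae] with τ hτ using hτ.mul_const _
    · refine hi.congr (Eventually.of_forall fun τ => ?_)
      simp only [norm_mul, Real.norm_eq_abs, abs_of_nonneg (hK.nonneg _ _), abs_of_nonneg (h0 _)]
      rw [integral_mul_const, mul_comm]
  · exact hK.integrable.aestronglyMeasurable.mul
      (hm.comp measurable_snd).aestronglyMeasurable

theorem integrable_mul_comp (hK : IsKernel μ K) (hg : IsNonlinearity g) (hC : CondC μ K g)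
    {u : ℝ → ℝ} {M : ℝ} (hu : AEMeasurable u) (hu0 : ∀ s, 0 ≤ u s) (huM : ∀ s, u s ≤ M) :
    Integrable (fun p : ℝ × X => K p.1 p.2 * g (u p.1) p.2) (volume.prod μ) := by
  have hM : 0 < max M 1 := by positivity
  obtain ⟨C, hm, h0, hb, hi, -⟩ := hC.exists_bound hK hM
  refine (hi.mul_const (max M 1)).mono'
    (hK.integrable.aestronglyMeasurable.mul (hg.aemeasurable_comp hu hu0).aestronglyMeasurable)
    (Eventually.of_forall fun p => ?_)
  have hle : u p.1 ≤ max M 1 := (huM _).trans (le_max_left _ _)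
  rw [norm_mul, Real.norm_eq_abs, Real.norm_eq_abs, abs_of_nonneg (hK.nonneg _ _),
    abs_of_nonneg (hg.nonneg _ (hu0 _) _), mul_assoc]
  gcongr
  · exact hK.nonneg _ _
  · exact (hb _ _ ⟨hu0 _, hle⟩).trans (by gcongr; exact h0 _)

/-- Continuity of the integral operator along boundedly pointwise convergent sequences. -/
theorem tendsto_integral_mul_comp (hK : IsKernel μ K) (hg : IsNonlinearity g)
    (hC : CondC μ K g) {u : ℕ → ℝ → ℝ} {v : ℝ → ℝ} {M : ℝ} (hu : ∀ n, AEMeasurable (u n))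
    (hu0 : ∀ n s, 0 ≤ u n s) (huM : ∀ n s, u n s ≤ M)
    (huv : ∀ s, Tendsto (fun n => u n s) atTop (𝓝 (v s))) :
    Tendsto (fun n => ∫ p : ℝ × X, K p.1 p.2 * g (u n p.1) p.2 ∂(volume.prod μ)) atTop
      (𝓝 (∫ p : ℝ × X, K p.1 p.2 * g (v p.1) p.2 ∂(volume.prod μ))) := by
  have hM : 0 < max M 1 := by positivity
  obtain ⟨C, hm, h0, hb, hi, -⟩ := hC.exists_bound hK hM
  refine tendsto_integral_of_dominated_convergence (fun p => K p.1 p.2 * C p.2 * max M 1)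
    (fun n => (integrable_mul_comp hK hg hC (hu n) (hu0 n) (huM n)).aestronglyMeasurable)
    (hi.mul_const _) (fun n => Eventually.of_forall fun p => ?_)
    (Eventually.of_forall fun p => ?_)
  · have hle : u n p.1 ≤ max M 1 := (huM _ _).trans (le_max_left _ _)
    rw [norm_mul, Real.norm_eq_abs, Real.norm_eq_abs, abs_of_nonneg (hK.nonneg _ _),
      abs_of_nonneg (hg.nonneg _ (hu0 _ _) _), mul_assoc]
    gcongr
    · exact hK.nonneg _ _
    · exact (hb _ _ ⟨hu0 _ _, hle⟩).trans (by gcongr; exact h0 _)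
  · refine Tendsto.const_mul _ ?_
    have hv0 : 0 ≤ v p.1 := ge_of_tendsto' (huv p.1) fun n => hu0 n _
    exact (hg.continuousOn p.2 _ hv0).tendsto.comp
      (tendsto_nhdsWithin_iff.2 ⟨huv _, Eventually.of_forall fun n => hu0 n _⟩)

theorem IsSolution.eq_prod {φ : ℝ → ℝ} (hφ : IsSolution μ K g φ) (t : ℝ) :
    φ t = ∫ p : ℝ × X, K p.1 p.2 * g (φ (t - p.1)) p.2 ∂(volume.prod μ) := by
  rw [hφ.eq t, integral_prod_symm _ (hφ.integrable t)]

/-! ### Uniform continuity of bounded solutions -/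

theorem tendsto_integral_prod_translate_sub {f : ℝ × X → ℝ} (hf : Integrable f (volume.prod μ)) :
    Tendsto (fun h : ℝ => ∫ p : ℝ × X, |f (p.1 + h, p.2) - f p| ∂(volume.prod μ))
      (𝓝 0) (𝓝 0) := by
  have hshift : ∀ h : ℝ, Integrable (fun p : ℝ × X => f (p.1 + h, p.2)) (volume.prod μ) :=
    fun h => ((measurePreserving_add_right volume h).prod
      (MeasurePreserving.id μ)).integrable_comp_of_integrable hf
  have hdiff : ∀ h : ℝ, Integrable (fun p : ℝ × X => |f (p.1 + h, p.2) - f p|)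
      (volume.prod μ) := fun h => ((hshift h).sub hf).abs
  simp_rw [fun h => integral_prod_symm _ (hdiff h)]
  have hz : (0 : ℝ) = ∫ _ : X, (0 : ℝ) ∂μ := by simp
  rw [hz]
  nth_rewrite 1 [← hz]
  refine tendsto_integral_filter_of_dominated_convergence
    (fun τ => 2 * ∫ s, |f (s, τ)|)
    (Eventually.of_forall fun h => (hdiff h).integral_prod_right.aestronglyMeasurable)
    (Eventually.of_forall fun h => ?_) (hf.abs.integral_prod_right.const_mul 2) ?_
  · filter_upwards [hf.prod_left_ae] with τ hτ
    have hτh : Integrable fun s => f (s + h, τ) := hτ.comp_add_right h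
    rw [Real.norm_eq_abs, abs_of_nonneg (integral_nonneg fun _ => abs_nonneg _)]
    calc ∫ s, |f (s + h, τ) - f (s, τ)| ≤ ∫ s, (|f (s + h, τ)| + |f (s, τ)|) :=
          integral_mono (hτh.sub hτ).abs (hτh.abs.add hτ.abs) fun s => abs_sub _ _
      _ = (∫ s, |f (s + h, τ)|) + ∫ s, |f (s, τ)| := integral_add hτh.abs hτ.abs
      _ = 2 * ∫ s, |f (s, τ)| := by
          rw [integral_add_right_eq_self (fun s => |f (s, τ)|) h]; ring
  · filter_upwards [hf.prod_left_ae] with τ hτ using tendsto_integral_translate_sub hτ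

theorem IsSolution.uniformContinuous (hK : IsKernel μ K) (hg : IsNonlinearity g)
    (hC : CondC μ K g) {φ : ℝ → ℝ} (hφ : IsSolution μ K g φ) {M : ℝ} (hM : ∀ t, φ t ≤ M) :
    UniformContinuous φ := by
  have hM1 : 0 < max M 1 := by positivity
  obtain ⟨C, hm, h0, hb, hi, -⟩ := hC.exists_bound hK hM1
  have hlim := (tendsto_integral_prod_translate_sub hi).mul_const (max M 1)
  rw [zero_mul] at hlim
  have hshiftK : ∀ h : ℝ, Integrable
      (fun p : ℝ × X => K (p.1 + h) p.2 * C p.2) (volume.prod μ) :=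
    fun h => ((measurePreserving_add_right volume h).prod
      (MeasurePreserving.id μ)).integrable_comp_of_integrable hi
  have hbound : ∀ t h, |φ (t + h) - φ t| ≤
      (∫ p : ℝ × X, |K (p.1 + h) p.2 * C p.2 - K p.1 p.2 * C p.2| ∂(volume.prod μ)) *
        max M 1 := by
    intro t h
    have hpres := (measurePreserving_add_right volume h).prod (MeasurePreserving.id μ)
    have hemb : MeasurableEmbedding (Prod.map (fun s : ℝ => s + h) (id : X → X)) :=
      ((MeasurableEquiv.addRight h).prodCongr (MeasurableEquiv.refl X)).measurableEmbedding
    have e1 : φ (t + h) = ∫ p : ℝ × X, K (p.1 + h) p.2 * g (φ (t - p.1)) p.2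
        ∂(volume.prod μ) := by
      rw [hφ.eq_prod (t + h), ← hpres.integral_comp hemb]
      simp
    have i1 : Integrable (fun p : ℝ × X => K (p.1 + h) p.2 * g (φ (t - p.1)) p.2)
        (volume.prod μ) := by
      have := hpres.integrable_comp_of_integrable (hφ.integrable (t + h))
      simpa [Function.comp_def] using this
    rw [e1, hφ.eq_prod t, ← integral_sub i1 (hφ.integrable t), ← integral_mul_const]
    refine (abs_integral_le_integral_abs).trans (integral_mono
      (i1.sub (hφ.integrable t)).abs (((hshiftK h).sub hi).abs.mul_const _) fun p => ?_)
    have hle : φ (t - p.1) ≤ max M 1 := (hM _).trans (le_max_left _ _)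
    have hgle : g (φ (t - p.1)) p.2 ≤ C p.2 * max M 1 :=
      (hb _ _ ⟨hφ.nonneg _, hle⟩).trans (by gcongr; exact h0 _)
    simp only
    rw [← sub_mul, ← sub_mul, abs_mul, abs_mul, abs_of_nonneg (hg.nonneg _ (hφ.nonneg _) _),
      abs_of_nonneg (h0 _), mul_assoc]
    gcongr
  rw [Metric.uniformContinuous_iff]
  intro ε hε
  obtain ⟨d, hd, hball⟩ := Metric.eventually_nhds_iff.1 (hlim.eventually (gt_mem_nhds hε))
  refine ⟨d, hd, fun {a b} hab => ?_⟩
  have := hball (y := a - b) (by simpa [Real.dist_eq] using hab)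
  have h2 := hbound b (a - b)
  rw [add_sub_cancel] at h2
  exact h2.trans_lt this

end ConvEq

namespace ConvEq

variable {X : Type*} [MeasurableSpace X] {μ : Measure X} {K g : ℝ → X → ℝ}

/-! ### A compactly supported linear minorant -/

theorem IsNonlinearity.tendsto_slope (hg : IsNonlinearity g) (τ : X) :
    Tendsto (fun v => v⁻¹ * g v τ) (𝓝[>] 0) (𝓝 (gPrime g τ)) := by
  have h := (hg.differentiable τ).hasDerivWithinAt
  rw [hasDerivWithinAt_iff_tendsto_slope] at h
  simpa [Ici_sdiff_left, slope_fun_def, hg.zero τ, gPrime] using h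

theorem IsNonlinearity.measurable_gPrime (hg : IsNonlinearity g) : Measurable (gPrime g) := by
  have hseq : Tendsto (fun n : ℕ => 1 / ((n : ℝ) + 1)) atTop (𝓝[>] 0) :=
    tendsto_nhdsWithin_iff.2 ⟨tendsto_one_div_add_atTop_nhds_zero_nat,
      Eventually.of_forall fun n => by simp only [mem_Ioi]; positivity⟩
  refine measurable_of_tendsto_metrizable
    (f := fun (n : ℕ) τ => (1 / ((n : ℝ) + 1))⁻¹ * g (1 / ((n : ℝ) + 1)) τ) (fun n => ?_) ?_
  · exact (hg.measurable_apply (by positivity)).const_mul _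
  · rw [tendsto_pi_nhds]
    exact fun τ => (hg.tendsto_slope τ).comp hseq

/-- A linear lower bound for `g(·, τ)` on rational points extends to all points. -/
theorem IsNonlinearity.le_of_forall_rat (hg : IsNonlinearity g) {τ : X} {η a : ℝ}
    (h : ∀ q : ℚ, 0 < (q : ℝ) → (q : ℝ) ≤ η → a * q ≤ g q τ) {v : ℝ} (hv : 0 ≤ v)
    (hvη : v ≤ η) : a * v ≤ g v τ := by
  rcases hv.eq_or_lt with rfl | hv
  · simp [hg.zero τ]
  by_contra! hlt
  have hc : ContinuousAt (fun w => a * w - g w τ) v :=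
    (continuous_const.mul continuous_id).continuousAt.sub
      ((hg.continuousOn τ).continuousAt (Ici_mem_nhds hv))
  have hev : ∀ᶠ w in 𝓝 v, 0 < a * w - g w τ := hc.eventually (lt_mem_nhds (sub_pos.2 hlt))
  obtain ⟨l, hl, hsub⟩ := exists_Ioc_subset_of_mem_nhds hev ⟨0, hv⟩
  obtain ⟨q, hq1, hq2⟩ := exists_rat_btwn (max_lt hl hv)
  have h1 := h q ((le_max_right _ _).trans_lt hq1) (hq2.le.trans hvη)
  have h2 : 0 < a * q - g q τ := hsub ⟨(le_max_left _ _).trans_lt hq1, hq2.le⟩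
  linarith

variable [IsFiniteMeasure μ]

/-- As `χ(0) < 0`, the integral operator dominates, on functions that are small on a window
`[-N, N]`, the integration against a kernel `k` on this window of total mass greater than one. -/
theorem exists_minorant (hK : IsKernel μ K) (hg : IsNonlinearity g) (hC : CondC μ K g)
    (hchi : chi μ K g 0 < 0) :
    ∃ η > 0, ∃ N > 0, ∃ k : ℝ → ℝ, (∀ s, 0 ≤ k s) ∧ Integrable k ∧
      1 < ∫ s in Icc (-N) N, k s ∧
      ∀ (u : ℝ → ℝ) (M : ℝ), AEMeasurable u → (∀ s, 0 ≤ u s) → (∀ s, u s ≤ M) →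
        (∀ s ∈ Icc (-N) N, u s ≤ η) →
        ∫ s in Icc (-N) N, k s * u s ≤
          ∫ p : ℝ × X, K p.1 p.2 * g (u p.1) p.2 ∂(volume.prod μ) := by
  have hI : 1 < ∫ p : ℝ × X, K p.1 p.2 * gPrime g p.2 ∂(volume.prod μ) := by
    have := hchi
    simp only [chi, mul_zero, Real.exp_zero, mul_one] at this
    linarith
  have hInt : Integrable (fun p : ℝ × X => K p.1 p.2 * gPrime g p.2) (volume.prod μ) := by
    by_contra h
    rw [integral_undef h] at hI
    linarith
  set I := ∫ p : ℝ × X, K p.1 p.2 * gPrime g p.2 ∂(volume.prod μ)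
  obtain ⟨c, hc1, hc2⟩ := exists_between (inv_lt_one_of_one_lt₀ hI)
  have hc0 : 0 < c := (inv_pos.2 (zero_lt_one.trans hI)).trans hc1
  have hcI : 1 < c * I := by
    rwa [inv_lt_iff_one_lt_mul₀ (zero_lt_one.trans hI)] at hc1
  -- On `A n` the linearisation at zero, reduced by the factor `c < 1`, is a lower bound for
  -- `g(·, τ)` on `[0, 1 / (n + 1)]`; rational points keep `A n` measurable.
  let A : ℕ → Set X := fun n =>
    {τ | ∀ q : ℚ, 0 < (q : ℝ) → (q : ℝ) ≤ 1 / ((n : ℝ) + 1) → c * gPrime g τ * q ≤ g q τ}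
  have hAmeas : ∀ n, MeasurableSet (A n) := by
    intro n
    simp only [A, ofPred_forall]
    refine MeasurableSet.iInter fun q => MeasurableSet.iInter fun hq =>
      MeasurableSet.iInter fun _ => ?_
    exact measurableSet_le ((hg.measurable_gPrime.const_mul c).mul_const _)
      (hg.measurable_apply hq.le)
  have hAmono : Monotone A := fun m n hmn τ hτ q hq hqn =>
    hτ q hq (hqn.trans (one_div_le_one_div_of_le (by positivity) (by gcongr)))
  have hAU : ∀ τ, ∃ n, τ ∈ A n := by
    intro τ
    have hlt : c * gPrime g τ < gPrime g τ := by
      have := hg.gPrime_pos τ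
      nlinarith
    have hev := (hg.tendsto_slope τ).eventually (lt_mem_nhds hlt)
    obtain ⟨d, hd, hsub⟩ := mem_nhdsGT_iff_exists_Ioc_subset.1 hev
    obtain ⟨n, hn⟩ := exists_nat_one_div_lt (mem_Ioi.1 hd)
    refine ⟨n, fun q hq hqn => ?_⟩
    have h1 : c * gPrime g τ < (q : ℝ)⁻¹ * g q τ := hsub ⟨hq, hqn.trans hn.le⟩
    rw [inv_mul_eq_div, lt_div_iff₀ hq] at h1
    exact h1.le
  let B : ℕ → Set (ℝ × X) := fun n => Icc (-((n : ℝ) + 1)) ((n : ℝ) + 1) ×ˢ A n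
  have hBmeas : ∀ n, MeasurableSet (B n) := fun n => measurableSet_Icc.prod (hAmeas n)
  have hBmono : Monotone B := fun m n hmn =>
    prod_mono (Icc_subset_Icc (by gcongr) (by gcongr)) (hAmono hmn)
  have hBU : ⋃ n, B n = univ := by
    refine eq_univ_of_forall fun p => mem_iUnion.2 ?_
    obtain ⟨n, hn⟩ := hAU p.2
    obtain ⟨m, hm⟩ := exists_nat_ge |p.1|
    refine ⟨max n m, ?_, hAmono (le_max_left _ _) hn⟩
    rw [mem_Icc, ← abs_le]
    push_cast
    exact hm.trans ((le_max_right _ _).trans (by linarith))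
  have hlim := tendsto_setIntegral_of_monotone (μ := volume.prod μ)
    (f := fun p : ℝ × X => K p.1 p.2 * gPrime g p.2) hBmeas hBmono hInt.integrableOn
  rw [hBU, setIntegral_univ] at hlim
  obtain ⟨n, hn⟩ := ((hlim.const_mul c).eventually (lt_mem_nhds hcI)).exists
  set N : ℝ := (n : ℝ) + 1 with hN
  have hNpos : 0 < N := by positivity
  set f : ℝ × X → ℝ := fun p => c * (K p.1 p.2 * gPrime g p.2) with hf
  have hf0 : ∀ p, 0 ≤ f p := fun p =>
    mul_nonneg hc0.le (mul_nonneg (hK.nonneg _ _) (hg.gPrime_pos _).le)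
  have hfI : Integrable f (volume.prod μ) := hInt.const_mul c
  have hfA : Integrable f (volume.prod (μ.restrict (A n))) := by
    have := hfI.integrableOn (s := univ ×ˢ A n)
    rwa [IntegrableOn, ← Measure.prod_restrict, Measure.restrict_univ] at this
  refine ⟨1 / N, by positivity, N, hNpos, fun s => ∫ τ in A n, f (s, τ) ∂μ,
    fun s => integral_nonneg fun _ => hf0 _, hfA.integral_prod_left, ?_, ?_⟩
  · rw [← setIntegral_prod _ hfI.integrableOn, hf, integral_const_mul]
    exact hn
  · intro u M hu hu0 huM huη
    have hfu : Integrable (fun p => f p * u p.1) (volume.prod μ) := by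
      refine hfI.mul_bdd (c := M) ?_ (Eventually.of_forall fun p => ?_)
      · exact (hu.comp_quasiMeasurePreserving
          Measure.quasiMeasurePreserving_fst).aestronglyMeasurable
      · rw [Real.norm_eq_abs, abs_of_nonneg (hu0 _)]
        exact huM _
    have hKg := integrable_mul_comp hK hg hC hu hu0 huM
    simp_rw [← integral_mul_const]
    rw [← setIntegral_prod (fun p : ℝ × X => f p * u p.1) hfu.integrableOn]
    calc ∫ p in Icc (-N) N ×ˢ A n, f p * u p.1 ∂(volume.prod μ)
        ≤ ∫ p in Icc (-N) N ×ˢ A n, K p.1 p.2 * g (u p.1) p.2 ∂(volume.prod μ) := by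
          refine setIntegral_mono_on hfu.integrableOn hKg.integrableOn (hBmeas n) fun p hp => ?_
          have := hg.le_of_forall_rat (τ := p.2) (a := c * gPrime g p.2) hp.2 (hu0 p.1)
            (huη _ hp.1)
          calc f p * u p.1 = K p.1 p.2 * (c * gPrime g p.2 * u p.1) := by simp only [hf]; ring
            _ ≤ _ := mul_le_mul_of_nonneg_left this (hK.nonneg _ _)
      _ ≤ _ := setIntegral_le_integral hKg (Eventually.of_forall fun p =>
          mul_nonneg (hK.nonneg _ _) (hg.nonneg _ (hu0 _) _))

end ConvEq

/-! ### Supersolutions of a linear convolution inequality -/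

section Supersolution

variable {k : ℝ → ℝ} {N : ℝ}

theorem integrableOn_mul_comp_sub (hk : Integrable k) {f : ℝ → ℝ} (hf : Continuous f) (t : ℝ) :
    IntegrableOn (fun s => k s * f (t - s)) (Icc (-N) N) :=
  hk.integrableOn.mul_continuousOn (by fun_prop) isCompact_Icc

/-- The inequality `f ≥ k * f`, integrated over an interval with the order of integration
exchanged on the left. -/
theorem integral_shift_le (hk : Integrable k) {f : ℝ → ℝ} (hf : Continuous f) {T : ℝ}
    (h : ∀ t ≤ T, ∫ s in Icc (-N) N, k s * f (t - s) ≤ f t) {x y : ℝ} (hxy : x ≤ y)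
    (hy : y ≤ T) :
    ∫ s in Icc (-N) N, k s * (∫ t in (x - s)..(y - s), f t) ≤ ∫ t in x..y, f t := by
  have hprod : IntegrableOn (fun p : ℝ × ℝ => k p.2 * f (p.1 - p.2))
      (Icc x y ×ˢ Icc (-N) N) (volume.prod volume) := by
    refine IntegrableOn.mul_continuousOn ?_ (by fun_prop) (isCompact_Icc.prod isCompact_Icc)
    rw [IntegrableOn, ← Measure.prod_restrict]
    exact hk.integrableOn.comp_snd _
  have hprod' : Integrable (fun p : ℝ × ℝ => k p.2 * f (p.1 - p.2))
      ((volume.restrict (Icc x y)).prod (volume.restrict (Icc (-N) N))) := by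
    rwa [Measure.prod_restrict]
  calc ∫ s in Icc (-N) N, k s * (∫ t in (x - s)..(y - s), f t)
      = ∫ s in Icc (-N) N, ∫ t in Icc x y, k s * f (t - s) := by
        refine integral_congr_ae (Eventually.of_forall fun s => ?_)
        simp only
        rw [integral_const_mul, integral_Icc_eq_integral_Ioc,
          ← intervalIntegral.integral_of_le hxy, intervalIntegral.integral_comp_sub_right]
    _ = ∫ t in Icc x y, ∫ s in Icc (-N) N, k s * f (t - s) :=
        (integral_integral_swap hprod').symm
    _ ≤ ∫ t in Icc x y, f t := by
        refine setIntegral_mono_on hprod'.integral_prod_left (hf.integrableOn_Icc)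
          measurableSet_Icc fun t ht => h t (ht.2.trans hy)
    _ = ∫ t in x..y, f t := by
        rw [integral_Icc_eq_integral_Ioc, intervalIntegral.integral_of_le hxy]

/-- A positive bounded function with `φ ≥ k * φ` near `-∞`, where `k ≥ 0` has total mass greater
than one, forces the first moment of `k` to be positive. Indeed `F(t) = ∫_{-∞}^t φ` is finite and
increasing with `F ≥ k * F`, and integrating `F - k * F` over `(-∞, T]` bounds
`(∫ k - 1) ∫_{-∞}^T F` by `F(T) ∫ s k(s) ds`. -/
theorem first_moment_pos_of_supersolution (hN : 0 < N) (hk0 : ∀ s, 0 ≤ k s) (hk : Integrable k)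
    (hk1 : 1 < ∫ s in Icc (-N) N, k s) {φ : ℝ → ℝ} (hφ : Continuous φ) (hφ0 : ∀ t, 0 < φ t)
    {M : ℝ} (hφM : ∀ t, φ t ≤ M) {T : ℝ}
    (h : ∀ t ≤ T, ∫ s in Icc (-N) N, k s * φ (t - s) ≤ φ t) :
    0 < ∫ s in Icc (-N) N, k s * s := by
  set κ := ∫ s in Icc (-N) N, k s with hκ
  have hM0 : 0 ≤ M := (hφ0 0).le.trans (hφM 0)
  have hint : ∀ a b, IntervalIntegrable φ volume a b := fun a b => hφ.intervalIntegrable a b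
  have hkI : IntegrableOn k (Icc (-N) N) := hk.integrableOn
  have hkmul : ∀ {f : ℝ → ℝ}, Continuous f → IntegrableOn (fun s => k s * f s) (Icc (-N) N) :=
    fun hf => hkI.mul_continuousOn hf.continuousOn isCompact_Icc
  set P : ℝ → ℝ := fun t => ∫ x in (0 : ℝ)..t, φ x with hP
  have hPsub : ∀ a b, P b - P a = ∫ x in a..b, φ x := fun a b =>
    intervalIntegral.integral_interval_sub_left (hint _ _) (hint _ _)
  have hPmono : StrictMono P := fun a b hab => by
    rw [← sub_pos, hPsub]
    exact intervalIntegral.intervalIntegral_pos_of_pos (hint _ _) hφ0 hab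
  have hPcont : Continuous P := intervalIntegral.continuous_primitive hint 0
  have hPlip : ∀ a b, a ≤ b → P b - P a ≤ M * (b - a) := by
    intro a b hab
    rw [hPsub]
    calc ∫ x in a..b, φ x ≤ ∫ _ in a..b, M :=
          intervalIntegral.integral_mono_on hab (hint _ _) (by simp) fun x _ => hφM x
      _ = M * (b - a) := by simp [mul_comm]
  have hPineq : ∀ x y, x ≤ y → y ≤ T →
      ∫ s in Icc (-N) N, k s * (P (y - s) - P (x - s)) ≤ P y - P x := by
    intro x y hxy hy
    simp_rw [hPsub]
    exact integral_shift_le hk hφ h hxy hy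
  -- The primitive is bounded below, so that it can be normalised to vanish at `-∞`.
  have hPbdd : BddBelow (range P) := by
    refine ⟨P T - 2 * M * N * κ / (κ - 1), ?_⟩
    rintro _ ⟨x, rfl⟩
    rcases le_total T x with hx | hx
    · have h1 := hPmono.monotone hx
      have h2 : 0 ≤ 2 * M * N * κ / (κ - 1) := 
        div_nonneg (by positivity) (by linarith)
      linarith
    · have h1 : κ * (P T - P x - 2 * M * N) ≤
          ∫ s in Icc (-N) N, k s * (P (T - s) - P (x - s)) := by
        rw [hκ, ← integral_mul_const]
        refine setIntegral_mono_on (hkI.mul_const _) (hkmul (by fun_prop)) measurableSet_Icc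
          fun s hs => mul_le_mul_of_nonneg_left ?_ (hk0 s)
        rcases le_total 0 s with h0 | h0
        · have e1 := hPlip (T - s) T (by linarith)
          have e2 := hPmono.monotone (show x - s ≤ x by linarith)
          have e3 : M * s ≤ M * N := mul_le_mul_of_nonneg_left hs.2 hM0
          have e4 : 0 ≤ M * N := by positivity
          nlinarith
        · have e1 := hPlip x (x - s) (by linarith)
          have e2 := hPmono.monotone (show T ≤ T - s by linarith)
          have e3 : M * (-s) ≤ M * N := mul_le_mul_of_nonneg_left (by linarith [hs.1]) hM0
          have e4 : 0 ≤ M * N := by positivity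
          nlinarith
      have h2 := h1.trans (hPineq x T hx le_rfl)
      have h3 : P T - P x ≤ 2 * M * N * κ / (κ - 1) := by
        rw [le_div_iff₀ (by linarith)]
        linarith
      linarith
  set F : ℝ → ℝ := fun t => P t - ⨅ x, P x with hF
  have hFlim : Tendsto F atBot (𝓝 0) := by
    have := (tendsto_atBot_ciInf hPmono.monotone hPbdd).sub_const (⨅ x, P x)
    simpa using this
  have hFcont : Continuous F := hPcont.sub continuous_const
  have hFmono : StrictMono F := fun a b hab => sub_lt_sub_right (hPmono hab) _
  have hF0 : ∀ t, 0 ≤ F t := fun t => sub_nonneg.2 (ciInf_le hPbdd t)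
  have hFint : ∀ a b, IntervalIntegrable F volume a b := fun a b => hFcont.intervalIntegrable a b
  have hFineq : ∀ t ≤ T, ∫ s in Icc (-N) N, k s * F (t - s) ≤ F t := by
    intro t ht
    have hlim : Tendsto (fun x => F t + κ * F (x + N)) atBot (𝓝 (F t + κ * 0)) :=
      ((hFlim.comp (tendsto_atBot_add_const_right _ N tendsto_id)).const_mul κ).const_add _
    rw [mul_zero, add_zero] at hlim
    refine ge_of_tendsto hlim ?_
    filter_upwards [eventually_le_atBot t] with x hx
    have h1 : (∫ s in Icc (-N) N, k s * F (t - s)) - κ * F (x + N) ≤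
        ∫ s in Icc (-N) N, k s * (P (t - s) - P (x - s)) := by
      rw [hκ, ← integral_mul_const, ← integral_sub (hkmul (by fun_prop)) (hkI.mul_const _)]
      refine setIntegral_mono_on ((hkmul (by fun_prop)).sub (hkI.mul_const _))
        (hkmul (by fun_prop)) measurableSet_Icc fun s hs => ?_
      rw [← mul_sub]
      refine mul_le_mul_of_nonneg_left ?_ (hk0 s)
      have := hFmono.monotone (show x - s ≤ x + N by linarith [hs.1])
      simp only [hF] at this ⊢
      linarith
    have h2 := hPineq x t hx ht
    have h3 := hF0 x
    simp only [hF] at h1 h3 ⊢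
    linarith
  -- Integrate once more, now over `[a, T]`, and let `a → -∞`.
  have hmain : ∀ a ≤ T, (κ - 1) * (∫ t in a..T, F t) ≤
      F T * (∫ s in Icc (-N) N, k s * s) + κ * (N * F (a + N)) := by
    intro a ha
    have h1 : κ * (∫ t in a..T, F t) - F T * (∫ s in Icc (-N) N, k s * s) -
        κ * (N * F (a + N)) ≤
        ∫ s in Icc (-N) N, k s * (∫ t in (a - s)..(T - s), F t) := by
      have hc : Continuous fun s => ∫ t in (a - s)..(T - s), F t := by
        have hc0 := intervalIntegral.continuous_primitive hFint 0
        have : (fun s => ∫ t in (a - s)..(T - s), F t) =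
            fun s => (∫ t in (0 : ℝ)..(T - s), F t) - ∫ t in (0 : ℝ)..(a - s), F t := by
          ext s
          exact (intervalIntegral.integral_interval_sub_left (hFint _ _) (hFint _ _)).symm
        rw [this]
        fun_prop
      have hid : IntegrableOn (fun s => k s * s) (Icc (-N) N) := hkmul continuous_id
      have hsub : IntegrableOn (fun s => k s * (∫ t in a..T, F t) - F T * (k s * s))
          (Icc (-N) N) := (hkI.mul_const _).sub (hid.const_mul _)
      rw [hκ, ← integral_mul_const, ← integral_mul_const, ← integral_const_mul,
        ← integral_sub (hkI.mul_const _) (hid.const_mul _),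
        ← integral_sub hsub (hkI.mul_const _)]
      refine setIntegral_mono_on (hsub.sub (hkI.mul_const _)) (hkmul hc)
        measurableSet_Icc fun s hs => ?_
      have hsplit : ∫ t in (a - s)..(T - s), F t =
          (∫ t in a..T, F t) - (∫ t in (T - s)..T, F t) + ∫ t in (a - s)..a, F t := by
        have e1 := intervalIntegral.integral_add_adjacent_intervals
          (hFint (a - s) a) (hFint a T)
        have e2 := intervalIntegral.integral_add_adjacent_intervals
          (hFint (a - s) (T - s)) (hFint (T - s) T)
        linarith
      have hT : ∫ t in (T - s)..T, F t ≤ s * F T := by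
        rcases le_total 0 s with h0 | h0
        · calc ∫ t in (T - s)..T, F t ≤ ∫ _ in (T - s)..T, F T :=
                intervalIntegral.integral_mono_on (by linarith) (hFint _ _) (by simp)
                  fun x hx => hFmono.monotone hx.2
            _ = s * F T := by simp
        · rw [intervalIntegral.integral_symm]
          have : ∫ _ in T..(T - s), F T ≤ ∫ t in T..(T - s), F t :=
            intervalIntegral.integral_mono_on (by linarith) (by simp) (hFint _ _)
              fun x hx => hFmono.monotone hx.1
          simp only [intervalIntegral.integral_const, smul_eq_mul] at this
          linarith
      have hA : -(N * F (a + N)) ≤ ∫ t in (a - s)..a, F t := by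
        have hFN : 0 ≤ F (a + N) := hF0 _
        rcases le_total 0 s with h0 | h0
        · have : 0 ≤ ∫ t in (a - s)..a, F t :=
            intervalIntegral.integral_nonneg (by linarith) fun x _ => hF0 x
          nlinarith
        · rw [intervalIntegral.integral_symm]
          have : ∫ t in a..(a - s), F t ≤ ∫ _ in a..(a - s), F (a + N) :=
            intervalIntegral.integral_mono_on (by linarith) (hFint _ _) (by simp)
              fun x hx => hFmono.monotone (by linarith [hx.2, hs.1])
          simp only [intervalIntegral.integral_const, smul_eq_mul] at this
          nlinarith [hs.1]
      have : (∫ t in a..T, F t) - s * F T - N * F (a + N) ≤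
          ∫ t in (a - s)..(T - s), F t := by linarith
      calc _ = k s * ((∫ t in a..T, F t) - s * F T - N * F (a + N)) := by
            ring
        _ ≤ _ := mul_le_mul_of_nonneg_left this (hk0 s)
    have h2 := h1.trans (integral_shift_le hk hFcont hFineq ha le_rfl)
    linarith
  have hJ : 0 < ∫ t in (T - 1)..T, F t :=
    intervalIntegral.intervalIntegral_pos_of_pos (hFint _ _)
      (fun t => (hF0 (t - 1)).trans_lt (hFmono (by linarith))) (by linarith)
  have hlim : Tendsto (fun a => F T * (∫ s in Icc (-N) N, k s * s) + κ * (N * F (a + N)))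
      atBot (𝓝 (F T * (∫ s in Icc (-N) N, k s * s) + κ * (N * 0))) :=
    (((hFlim.comp (tendsto_atBot_add_const_right _ N tendsto_id)).const_mul N).const_mul
      κ).const_add _
  have hfin : (κ - 1) * (∫ t in (T - 1)..T, F t) ≤ F T * (∫ s in Icc (-N) N, k s * s) := by
    rw [mul_zero, mul_zero, add_zero] at hlim
    refine ge_of_tendsto hlim ?_
    filter_upwards [eventually_le_atBot (T - 1)] with a ha
    refine le_trans (mul_le_mul_of_nonneg_left ?_ (by linarith)) (hmain a (by linarith))
    have e := intervalIntegral.integral_add_adjacent_intervals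
      (hFint a (T - 1)) (hFint (T - 1) T)
    have : 0 ≤ ∫ t in a..(T - 1), F t := intervalIntegral.integral_nonneg ha fun x _ => hF0 x
    linarith
  have hpos : 0 < (κ - 1) * (∫ t in (T - 1)..T, F t) := mul_pos (by linarith) hJ
  exact pos_of_mul_pos_right (hpos.trans_le hfin) (hF0 T)

/-- The inequality `φ ≥ k * φ` cannot hold near both ends of the line: the first moment of `k`
would have to be both positive and negative. -/
theorem not_supersolution_both_ends (hN : 0 < N) (hk0 : ∀ s, 0 ≤ k s) (hk : Integrable k)
    (hk1 : 1 < ∫ s in Icc (-N) N, k s) {φ : ℝ → ℝ} (hφ : Continuous φ) (hφ0 : ∀ t, 0 < φ t)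
    {M : ℝ} (hφM : ∀ t, φ t ≤ M) {S T : ℝ}
    (hbot : ∀ t ≤ S, ∫ s in Icc (-N) N, k s * φ (t - s) ≤ φ t)
    (htop : ∀ t ≥ T, ∫ s in Icc (-N) N, k s * φ (t - s) ≤ φ t) : False := by
  have hreflect : ∀ f : ℝ → ℝ, ∫ s in Icc (-N) N, f (-s) = ∫ s in Icc (-N) N, f s := by
    intro f
    rw [integral_Icc_eq_integral_Ioc, integral_Icc_eq_integral_Ioc,
      ← intervalIntegral.integral_of_le (by linarith),
      ← intervalIntegral.integral_of_le (by linarith), intervalIntegral.integral_comp_neg, neg_neg]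
  have h1 := first_moment_pos_of_supersolution hN hk0 hk hk1 hφ hφ0 hφM hbot
  have h2 : 0 < ∫ s in Icc (-N) N, k (-s) * s := by
    refine first_moment_pos_of_supersolution (k := fun s => k (-s)) (φ := fun t => φ (-t))
      (T := -T) hN (fun s => hk0 _) hk.comp_neg ?_ (hφ.comp continuous_neg) (fun t => hφ0 _)
      (fun t => hφM _) fun t ht => ?_
    · rwa [hreflect k]
    · have := htop (-t) (by linarith)
      rw [← hreflect] at this
      convert this using 4
      ring_nf
  have h3 := hreflect fun s => k s * s
  simp only [mul_neg, integral_neg] at h3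
  linarith

end Supersolution

/-! ### Compactness of translates -/

/-- Along a subsequence, the translates of a bounded uniformly continuous function converge
pointwise to a continuous function. -/
theorem exists_subseq_tendsto_translates {φ : ℝ → ℝ} (hφ : UniformContinuous φ) {a b : ℝ}
    (hab : ∀ t, φ t ∈ Icc a b) (t : ℕ → ℝ) :
    ∃ (ψ : ℝ → ℝ) (n : ℕ → ℕ), StrictMono n ∧ Continuous ψ ∧ (∀ s, ψ s ∈ Icc a b) ∧
      ∀ s, Tendsto (fun i => φ (t (n i) + s)) atTop (𝓝 (ψ s)) := by
  have hcomp : IsCompact (univ.pi fun _ : ℚ => Icc a b) :=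
    isCompact_univ_pi fun _ => isCompact_Icc
  -- Compactness of a countable product gives convergence at rational points, and equicontinuity
  -- extends it to all points.
  obtain ⟨ρ, -, n, hn, hlim⟩ := hcomp.tendsto_subseq
    (x := fun i (q : ℚ) => φ (t i + q)) fun i q _ => hab _
  rw [tendsto_pi_nhds] at hlim
  rw [Metric.uniformContinuous_iff] at hφ
  have hcauchy : ∀ s, CauchySeq fun i => φ (t (n i) + s) := by
    intro s
    rw [Metric.cauchySeq_iff]
    intro ε hε
    obtain ⟨d, hd, hφd⟩ := hφ (ε / 3) (by positivity)
    obtain ⟨q, hq1, hq2⟩ := exists_rat_btwn (show s < s + d by linarith)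
    obtain ⟨m, hm⟩ := Metric.cauchySeq_iff.1 (hlim q).cauchySeq (ε / 3) (by positivity)
    refine ⟨m, fun i hi j hj => ?_⟩
    have hclose : ∀ i, dist (φ (t (n i) + s)) (φ (t (n i) + q)) < ε / 3 := fun i => by
      apply hφd
      rw [dist_add_left, Real.dist_eq, abs_sub_lt_iff]
      constructor <;> linarith
    have h1 := hclose i
    have h2 := hclose j
    rw [dist_comm] at h2
    have h3 := hm i hi j hj
    simp only [Function.comp] at h3
    have h4 := dist_triangle4 (φ (t (n i) + s)) (φ (t (n i) + q)) (φ (t (n j) + q))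
      (φ (t (n j) + s))
    linarith
  choose ψ hψ using fun s => cauchySeq_tendsto_of_complete (hcauchy s)
  refine ⟨ψ, n, hn, ?_, fun s => isClosed_Icc.mem_of_tendsto (hψ s)
    (Eventually.of_forall fun i => hab _), hψ⟩
  refine UniformContinuous.continuous (Metric.uniformContinuous_iff.2 fun ε hε => ?_)
  obtain ⟨d, hd, hφd⟩ := hφ (ε / 2) (by positivity)
  refine ⟨d, hd, fun {x y} hxy => ?_⟩
  refine lt_of_le_of_lt (le_of_tendsto' ((hψ x).dist (hψ y)) fun i => ?_) (half_lt_self hε)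
  exact (hφd (by rwa [dist_add_left])).le

namespace ConvEq

variable {X : Type*} [MeasurableSpace X] {μ : Measure X} [IsFiniteMeasure μ] {K g : ℝ → X → ℝ}

/-- Pointwise limits of translates of a bounded solution are solutions. -/
theorem IsSolution.of_tendsto_translates (hK : IsKernel μ K) (hg : IsNonlinearity g)
    (hC : CondC μ K g) {φ ψ : ℝ → ℝ} (hφ : IsSolution μ K g φ) {M : ℝ} (hM : ∀ t, φ t ≤ M)
    {t : ℕ → ℝ} (hψ : Continuous ψ)
    (hlim : ∀ s, Tendsto (fun i => φ (t i + s)) atTop (𝓝 (ψ s))) : IsSolution μ K g ψ := by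
  have hψ0 : ∀ s, 0 ≤ ψ s := fun s => ge_of_tendsto' (hlim s) fun i => hφ.nonneg _
  have hψM : ∀ s, ψ s ≤ M := fun s => le_of_tendsto' (hlim s) fun i => hM _
  have hint : ∀ x, Integrable (fun p : ℝ × X => K p.1 p.2 * g (ψ (x - p.1)) p.2)
      (volume.prod μ) := fun x =>
    integrable_mul_comp hK hg hC (by fun_prop : Continuous fun s => ψ (x - s)).aemeasurable
      (fun s => hψ0 _) (fun s => hψM _)
  refine ⟨hψ0, hψ.aemeasurable, hint, fun x => ?_⟩
  rw [← integral_prod_symm _ (hint x)]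
  refine tendsto_nhds_unique (hlim x) ?_
  simp_rw [fun i => hφ.eq_prod (t i + x)]
  refine tendsto_integral_mul_comp hK hg hC (u := fun i s => φ (t i + x - s))
    (v := fun s => ψ (x - s)) (M := M) (fun i => hφ.aemeasurable_sub _)
    (fun i s => hφ.nonneg _) (fun i s => hM _) fun s => ?_
  simp_rw [add_sub_assoc]
  exact hlim (x - s)

/-- By condition (P) and compactness, a bounded solution that is small at a point is small on a
long interval around it. -/
theorem IsSolution.exists_small_near (hK : IsKernel μ K) (hg : IsNonlinearity g)
    (hC : CondC μ K g) (hP : CondP μ K g) {φ : ℝ → ℝ} (hφ : IsSolution μ K g φ) {M : ℝ}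
    (hM : ∀ t, φ t ≤ M) (N : ℝ) {ε : ℝ} (hε : 0 < ε) :
    ∃ δ > 0, ∀ t, φ t < δ → ∀ s ∈ Icc (-N) N, φ (t + s) < ε := by
  by_contra! hcon
  choose t ht s hs hts using fun n : ℕ => hcon (1 / ((n : ℝ) + 1)) (by positivity)
  obtain ⟨s₀, -, m, hm, hslim⟩ := isCompact_Icc.tendsto_subseq hs
  have huc := hφ.uniformContinuous hK hg hC hM
  obtain ⟨ψ, n, hn, hψc, hψM, hlim⟩ := exists_subseq_tendsto_translates huc
    (fun x => ⟨hφ.nonneg x, hM x⟩) (t ∘ m)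
  have hψ := hφ.of_tendsto_translates hK hg hC hM hψc hlim
  have hψ0 : ψ 0 = 0 := by
    refine le_antisymm ?_ (hψM 0).1
    refine le_of_tendsto_of_tendsto (hlim 0)
      (tendsto_one_div_add_atTop_nhds_zero_nat.comp (hm.comp hn).tendsto_atTop)
      (Eventually.of_forall fun i => ?_)
    simpa using (ht (m (n i))).le
  have hzero := hP ψ hψ ⟨M, by rintro _ ⟨x, rfl⟩; exact (hψM x).2⟩ ⟨0, hψ0⟩ s₀
  have hdist : Tendsto (fun i => dist (φ (t (m (n i)) + s (m (n i)))) (φ (t (m (n i)) + s₀)))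
      atTop (𝓝 0) := by
    rw [Metric.uniformContinuous_iff] at huc
    rw [Metric.tendsto_atTop]
    intro r hr
    obtain ⟨d, hd, hφd⟩ := huc r hr
    obtain ⟨i₀, hi₀⟩ := Metric.tendsto_atTop.1 (hslim.comp hn.tendsto_atTop) d hd
    refine ⟨i₀, fun i hi => ?_⟩
    rw [Real.dist_0_eq_abs, abs_of_nonneg dist_nonneg]
    exact hφd (by rw [dist_add_left]; exact hi₀ i hi)
  have hsum := (hlim s₀).add hdist
  rw [hzero, add_zero] at hsum
  refine hε.not_ge (ge_of_tendsto' hsum fun i => ?_)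
  have h1 := hts (m (n i))
  have h2 := le_abs_self (φ (t (m (n i)) + s (m (n i))) - φ (t (m (n i)) + s₀))
  rw [← Real.dist_eq] at h2
  simp only [Function.comp]
  linarith

/-- A bounded positive solution cannot be very small between two points at which it is not small:
at the minimum in between, the linear minorant of total mass greater than one would make the
solution exceed its own value. -/
theorem IsSolution.exists_small_imp_or (hK : IsKernel μ K) (hg : IsNonlinearity g)
    (hC : CondC μ K g) (hP : CondP μ K g) (hchi : chi μ K g 0 < 0) {φ : ℝ → ℝ}
    (hφ : IsSolution μ K g φ) (hpos : ∀ t, 0 < φ t) {M : ℝ} (hM : ∀ t, φ t ≤ M)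
    {ε : ℝ} (hε : 0 < ε) :
    ∃ δ > 0, ∀ a b c, a ≤ c → c ≤ b → φ c < δ → φ a < ε ∨ φ b < ε := by
  obtain ⟨η, hη, N, hN, k, hk0, hk, hk1, hmin⟩ := exists_minorant hK hg hC hchi
  obtain ⟨δ, hδ, hsmall⟩ := hφ.exists_small_near hK hg hC hP hM N (lt_min hε hη)
  have hcont := (hφ.uniformContinuous hK hg hC hM).continuous
  refine ⟨δ, hδ, fun a b c hac hcb hc => ?_⟩
  by_contra! hab
  obtain ⟨x, hx, hxmin⟩ := isCompact_Icc.exists_isMinOn ⟨c, hac, hcb⟩ hcont.continuousOn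
  have hxδ : φ x < δ := (hxmin ⟨hac, hcb⟩).trans_lt hc
  have hnear := hsmall x hxδ
  have hxa : N < x - a := by
    by_contra! hle
    have := hnear (a - x) ⟨by linarith, by linarith [hx.1]⟩
    rw [add_sub_cancel] at this
    exact (this.trans_le (min_le_left _ _)).not_ge hab.1
  have hxb : N < b - x := by
    by_contra! hle
    have := hnear (b - x) ⟨by linarith [hx.2], by linarith⟩
    rw [add_sub_cancel] at this
    exact (this.trans_le (min_le_left _ _)).not_ge hab.2
  have h1 := hmin (fun s => φ (x - s)) M (hφ.aemeasurable_sub x) (fun s => hφ.nonneg _)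
    (fun s => hM _) fun s hs => by
      have := hnear (-s) ⟨by linarith [hs.2], by linarith [hs.1]⟩
      exact (this.trans_le (min_le_right _ _)).le
  rw [← hφ.eq_prod x] at h1
  have h2 : (∫ s in Icc (-N) N, k s) * φ x ≤ ∫ s in Icc (-N) N, k s * φ (x - s) := by
    rw [← integral_mul_const]
    refine setIntegral_mono_on (hk.integrableOn.mul_const _)
      (integrableOn_mul_comp_sub hk hcont x) measurableSet_Icc fun s hs =>
        mul_le_mul_of_nonneg_left (hxmin ⟨?_, ?_⟩) (hk0 s)
    · linarith [hs.2]
    · linarith [hs.1]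
  have h3 := hpos x
  nlinarith

/-- A bounded positive solution does not vanish at both ends of the line. -/
theorem IsSolution.not_tendsto_zero_both (hK : IsKernel μ K) (hg : IsNonlinearity g)
    (hC : CondC μ K g) (hchi : chi μ K g 0 < 0) {φ : ℝ → ℝ}
    (hφ : IsSolution μ K g φ) (hpos : ∀ t, 0 < φ t) {M : ℝ} (hM : ∀ t, φ t ≤ M)
    (hbot : Tendsto φ atBot (𝓝 0)) (htop : Tendsto φ atTop (𝓝 0)) : False := by
  obtain ⟨η, hη, N, hN, k, hk0, hk, hk1, hmin⟩ := exists_minorant hK hg hC hchi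
  have hcont := (hφ.uniformContinuous hK hg hC hM).continuous
  obtain ⟨S, hS⟩ := eventually_atBot.1 (hbot.eventually (gt_mem_nhds hη))
  obtain ⟨T, hT⟩ := eventually_atTop.1 (htop.eventually (gt_mem_nhds hη))
  refine not_supersolution_both_ends hN hk0 hk hk1 hcont hpos hM (S := S - N) (T := T + N)
    (fun t ht => ?_) fun t ht => ?_
  · rw [hφ.eq_prod t]
    exact hmin (fun s => φ (t - s)) M (hφ.aemeasurable_sub t) (fun s => hφ.nonneg _)
      (fun s => hM _) fun s hs => (hS _ (by linarith [hs.1])).le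
  · rw [hφ.eq_prod t]
    exact hmin (fun s => φ (t - s)) M (hφ.aemeasurable_sub t) (fun s => hφ.nonneg _)
      (fun s => hM _) fun s hs => (hT _ (by linarith [hs.2])).le

end ConvEq

namespace ConvEq

variable {X : Type*} [MeasurableSpace X] {μ : Measure X} {K g : ℝ → X → ℝ}
  {τ₀ : X} {ζ₁ ζ₂ : ℝ}

/-! ### The reduced map `G` -/

/-- A property that holds almost everywhere holds at the atom `τ₀`. -/
theorem CondN.of_ae (hN : CondN μ K g τ₀ ζ₂) {p : X → Prop} (h : ∀ᵐ τ ∂μ, p τ) : p τ₀ := by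
  by_contra hp
  have : μ {τ₀} = 0 := measure_mono_null (singleton_subset_iff.2 hp) h
  simp [hN.mass_one] at this

theorem Theta_zero (hg : IsNonlinearity g) : Theta μ K g τ₀ 0 = 0 := by
  simp [Theta, gTilde, hg.zero]

variable [IsFiniteMeasure μ]

theorem CondN.integrable_kernel (hK : IsKernel μ K) (hN : CondN μ K g τ₀ ζ₂) :
    Integrable fun s => K s τ₀ :=
  hN.of_ae hK.integrable.prod_left_ae

theorem CondN.kernel_integral_pos (hK : IsKernel μ K) (hN : CondN μ K g τ₀ ζ₂) :
    0 < ∫ s, K s τ₀ := by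
  have h := hK.pos τ₀
  rw [← ofReal_integral_eq_lintegral_ofReal (hN.integrable_kernel hK)
    (Eventually.of_forall fun s => hK.nonneg s τ₀)] at h
  exact ENNReal.ofReal_pos.1 h

theorem integrable_gTilde (hK : IsKernel μ K) (hg : IsNonlinearity g) (hC : CondC μ K g)
    {v : ℝ} (hv : 0 ≤ v) : Integrable (fun τ => g v τ * ∫ s, K s τ) μ := by
  have h := (integrable_mul_comp hK hg hC (u := fun _ => v) (M := v) aemeasurable_const
    (fun _ => hv) fun _ => le_rfl).integral_prod_right
  refine h.congr (Eventually.of_forall fun τ => ?_)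
  simp only
  rw [integral_mul_const, mul_comm]

theorem continuousOn_gTilde (hK : IsKernel μ K) (hg : IsNonlinearity g) (hC : CondC μ K g)
    {δ : ℝ} (hδ : 0 < δ) : ContinuousOn (gTilde μ K g τ₀) (Icc 0 δ) := by
  obtain ⟨C, -, h0, hb, -, hi⟩ := hC.exists_bound hK hδ
  have hJ : ∀ τ, 0 ≤ ∫ s, K s τ := fun τ => integral_nonneg fun s => hK.nonneg s τ
  refine continuousOn_of_dominated (bound := fun τ => (C τ * ∫ s, K s τ) * δ)
    (fun v hv => (integrable_gTilde hK hg hC hv.1).integrableOn.aestronglyMeasurable)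
    (fun v hv => Eventually.of_forall fun τ => ?_) (hi.mul_const δ).integrableOn
    (Eventually.of_forall fun τ =>
      ((hg.continuousOn τ).mono Icc_subset_Ici_self).mul continuousOn_const)
  rw [norm_mul, Real.norm_eq_abs, Real.norm_eq_abs, abs_of_nonneg (hg.nonneg _ hv.1 _),
    abs_of_nonneg (hJ τ), mul_right_comm]
  refine mul_le_mul_of_nonneg_right ?_ (hJ τ)
  exact (hb τ v hv).trans (mul_le_mul_of_nonneg_left hv.2 (h0 τ))

theorem continuousOn_Theta (hK : IsKernel μ K) (hg : IsNonlinearity g) (hC : CondC μ K g)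
    {δ : ℝ} (hδ : 0 < δ) : ContinuousOn (Theta μ K g τ₀) (Icc 0 δ) :=
  continuousOn_id.sub (continuousOn_gTilde hK hg hC hδ)

/-- The contribution of the atom `τ₀`, of mass one, split off from the integral operator. -/
theorem CondN.integral_eq_add (hK : IsKernel μ K) (hg : IsNonlinearity g)
    (hC : CondC μ K g) (hN : CondN μ K g τ₀ ζ₂) {u : ℝ → ℝ} {M : ℝ} (hu : AEMeasurable u)
    (hu0 : ∀ s, 0 ≤ u s) (huM : ∀ s, u s ≤ M) :
    ∫ p : ℝ × X, K p.1 p.2 * g (u p.1) p.2 ∂(volume.prod μ) =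
      (∫ τ in {τ₀}ᶜ, (∫ s, K s τ * g (u s) τ) ∂μ) + ∫ s, K s τ₀ * g (u s) τ₀ := by
  have hint := integrable_mul_comp hK hg hC hu hu0 huM
  rw [integral_prod_symm _ hint,
    ← integral_add_compl hN.measurableSet_singleton hint.integral_prod_right,
    setIntegral_congr_fun (g := fun _ => ∫ s, K s τ₀ * g (u s) τ₀) hN.measurableSet_singleton
      (fun τ hτ => by simp only [mem_singleton_iff.1 hτ]),
    setIntegral_const, measureReal_def, hN.mass_one, add_comm]
  simp

/-- Lower bound for the integral operator on functions with values in `[m, M]`: the components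
`τ ≠ τ₀` are bounded by monotonicity, the component `τ₀` by a lower bound for `g(·, τ₀)`. -/
theorem CondN.gTilde_add_le (hK : IsKernel μ K) (hg : IsNonlinearity g)
    (hC : CondC μ K g) (hN : CondN μ K g τ₀ ζ₂) {u : ℝ → ℝ} {m M c : ℝ} (hu : AEMeasurable u)
    (hm : 0 ≤ m) (hum : ∀ s, m ≤ u s) (huM : ∀ s, u s ≤ M) (hc : ∀ v ∈ Icc m M, c ≤ g v τ₀) :
    gTilde μ K g τ₀ m + (∫ s, K s τ₀) * c ≤
      ∫ p : ℝ × X, K p.1 p.2 * g (u p.1) p.2 ∂(volume.prod μ) := by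
  have hu0 : ∀ s, 0 ≤ u s := fun s => hm.trans (hum s)
  have hint := integrable_mul_comp hK hg hC hu hu0 huM
  rw [hN.integral_eq_add hK hg hC hu hu0 huM]
  refine add_le_add ?_ ?_
  · refine setIntegral_mono_on_ae (integrable_gTilde hK hg hC hm).integrableOn
      hint.integral_prod_right.integrableOn hN.measurableSet_singleton.compl ?_
    filter_upwards [hK.integrable.prod_left_ae, hint.prod_left_ae] with τ h1 h2 hτ
    rw [mul_comm, ← integral_mul_const]
    exact integral_mono (h1.mul_const _) h2 fun s =>
      mul_le_mul_of_nonneg_left (hN.mono τ hτ hm (hu0 s) (hum s)) (hK.nonneg s τ)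
  · rw [← integral_mul_const]
    exact integral_mono ((hN.integrable_kernel hK).mul_const _) (hN.of_ae hint.prod_left_ae)
      fun s => mul_le_mul_of_nonneg_left (hc _ ⟨hum s, huM s⟩) (hK.nonneg s τ₀)

theorem CondN.le_gTilde_add (hK : IsKernel μ K) (hg : IsNonlinearity g)
    (hC : CondC μ K g) (hN : CondN μ K g τ₀ ζ₂) {u : ℝ → ℝ} {m M c : ℝ} (hu : AEMeasurable u)
    (hm : 0 ≤ m) (hum : ∀ s, m ≤ u s) (huM : ∀ s, u s ≤ M) (hc : ∀ v ∈ Icc m M, g v τ₀ ≤ c) :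
    ∫ p : ℝ × X, K p.1 p.2 * g (u p.1) p.2 ∂(volume.prod μ) ≤
      gTilde μ K g τ₀ M + (∫ s, K s τ₀) * c := by
  have hu0 : ∀ s, 0 ≤ u s := fun s => hm.trans (hum s)
  have hM : 0 ≤ M := (hu0 0).trans (huM 0)
  have hint := integrable_mul_comp hK hg hC hu hu0 huM
  rw [hN.integral_eq_add hK hg hC hu hu0 huM]
  refine add_le_add ?_ ?_
  · refine setIntegral_mono_on_ae hint.integral_prod_right.integrableOn
      (integrable_gTilde hK hg hC hM).integrableOn hN.measurableSet_singleton.compl ?_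
    filter_upwards [hK.integrable.prod_left_ae, hint.prod_left_ae] with τ h1 h2 hτ
    rw [mul_comm (g M τ), ← integral_mul_const]
    exact integral_mono h2 (h1.mul_const _) fun s =>
      mul_le_mul_of_nonneg_left (hN.mono τ hτ (hu0 s) hM (huM s)) (hK.nonneg s τ)
  · rw [← integral_mul_const]
    exact integral_mono (hN.of_ae hint.prod_left_ae) ((hN.integrable_kernel hK).mul_const _)
      fun s => mul_le_mul_of_nonneg_left (hc _ ⟨hum s, huM s⟩) (hK.nonneg s τ₀)

theorem CondN.G_spec (hK : IsKernel μ K) (hg : IsNonlinearity g) (hC : CondC μ K g)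
    (hN : CondN μ K g τ₀ ζ₂) {v : ℝ} (hv : 0 ≤ v) :
    G μ K g τ₀ ζ₂ v ∈ Icc 0 ζ₂ ∧
      Theta μ K g τ₀ (G μ K g τ₀ ζ₂ v) = (∫ s, K s τ₀) * g v τ₀ := by
  have hCpos := hN.kernel_integral_pos hK
  have hmem : (∫ s, K s τ₀) * g v τ₀ ∈
      Icc (Theta μ K g τ₀ 0) (Theta μ K g τ₀ ζ₂) := by
    rw [Theta_zero hg]
    refine ⟨mul_nonneg hCpos.le (hg.nonneg v hv τ₀), le_trans ?_ hN.theta_gt.le⟩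
    exact mul_le_mul_of_nonneg_left (le_csSup hN.bdd ⟨v, hv, rfl⟩) hCpos.le
  have hex := intermediate_value_Icc hN.zeta_pos.le
    (continuousOn_Theta hK hg hC hN.zeta_pos) hmem
  exact ⟨Function.invFunOn_mem hex, Function.invFunOn_eq hex⟩

/-- Near zero `G` lies above the diagonal, since `χ(0) < 0`. -/
theorem CondN.exists_forall_lt_G (hK : IsKernel μ K) (hg : IsNonlinearity g)
    (hC : CondC μ K g) (hchi : chi μ K g 0 < 0) (hN : CondN μ K g τ₀ ζ₂) :
    ∃ ε, 0 < ε ∧ ε < ζ₂ ∧ ∀ s ∈ Ioc 0 ε, s < G μ K g τ₀ ζ₂ s := by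
  obtain ⟨η, hη, N, -, k, -, -, hk1, hmin⟩ := exists_minorant hK hg hC hchi
  have hζ := hN.zeta_pos
  refine ⟨min η (ζ₂ / 2), lt_min hη (half_pos hζ),
    (min_le_right _ _).trans_lt (half_lt_self hζ), fun s hs => ?_⟩
  have hsη : s ≤ η := hs.2.trans (min_le_left _ _)
  have hsζ : s ≤ ζ₂ := hs.2.trans ((min_le_right _ _).trans (half_le_self hζ.le))
  have h1 := hmin (fun _ => s) s aemeasurable_const (fun _ => hs.1.le) (fun _ => le_rfl)
    fun _ _ => hsη
  have h2 := hN.le_gTilde_add hK hg hC (u := fun _ => s) (m := s) (M := s) (c := g s τ₀)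
    aemeasurable_const hs.1.le (fun _ => le_rfl) (fun _ => le_rfl)
    fun v hv => by rw [le_antisymm hv.2 hv.1]
  rw [integral_mul_const] at h1
  obtain ⟨hGmem, hGeq⟩ := hN.G_spec hK hg hC hs.1.le
  rw [← hN.theta_strictMono.lt_iff_lt ⟨hs.1.le, hsζ⟩ hGmem, hGeq, Theta]
  have := hs.1
  nlinarith

/-- As `Θ` is increasing, values of `G` compare like values of `g(·, τ₀)`, and no continuity of `G`
is needed to select `ζ₁`. -/
theorem CondN.exists_isZeta1 (hK : IsKernel μ K) (hg : IsNonlinearity g)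
    (hC : CondC μ K g) (hchi : chi μ K g 0 < 0) (hN : CondN μ K g τ₀ ζ₂) :
    ∃ ζ₁, IsZeta1 μ K g τ₀ ζ₂ ζ₁ := by
  obtain ⟨ε, hε, hεζ, hlt⟩ := hN.exists_forall_lt_G hK hg hC hchi
  have hcont : ContinuousOn (fun v => g v τ₀) (Ici 0) := hg.continuousOn τ₀
  have hGle : ∀ {a b : ℝ}, 0 ≤ a → 0 ≤ b → g a τ₀ ≤ g b τ₀ →
      G μ K g τ₀ ζ₂ a ≤ G μ K g τ₀ ζ₂ b := by
    intro a b ha hb hab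
    obtain ⟨h1, h2⟩ := hN.G_spec hK hg hC ha
    obtain ⟨h3, h4⟩ := hN.G_spec hK hg hC hb
    rw [← hN.theta_strictMono.le_iff_le h1 h3, h2, h4]
    exact mul_le_mul_of_nonneg_left hab (hN.kernel_integral_pos hK).le
  obtain ⟨x, hx, hxmin⟩ := isCompact_Icc.exists_isMinOn (nonempty_Icc.2 hεζ.le)
    (hcont.mono fun v (hv : v ∈ Icc ε ζ₂) => hε.le.trans hv.1)
  have hgx : 0 < g x τ₀ := hN.pos x (hε.trans_le hx.1)
  -- `ζ₁` is the last point of `[0, ε]` where `g(·, τ₀)` does not exceed its minimum on `[ε, ζ₂]`.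
  have hScomp : IsCompact (Icc 0 ε ∩ (fun v => g v τ₀) ⁻¹' Iic (g x τ₀)) :=
    isCompact_Icc.of_isClosed_subset
      ((hcont.mono Icc_subset_Ici_self).preimage_isClosed_of_isClosed isClosed_Icc isClosed_Iic)
      inter_subset_left
  have hSne : (Icc 0 ε ∩ (fun v => g v τ₀) ⁻¹' Iic (g x τ₀)).Nonempty :=
    ⟨0, ⟨le_rfl, hε.le⟩, by simpa [hg.zero] using hgx.le⟩
  obtain ⟨z, ⟨hz, hzx⟩, hzmax⟩ := hScomp.exists_isGreatest hSne
  have hzx' : g z τ₀ ≤ g x τ₀ := hzx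
  have hz0 : 0 < z := by
    have hev : ∀ᶠ v in 𝓝[>] (0 : ℝ), g v τ₀ < g x τ₀ := by
      refine (hcont 0 self_mem_Ici).mono_left (nhdsWithin_mono _ Ioi_subset_Ici_self) |>.eventually
        (gt_mem_nhds ?_)
      simpa [hg.zero] using hgx
    obtain ⟨v, hv1, hv2⟩ := (hev.and (Ioc_mem_nhdsGT hε)).exists
    exact hv2.1.trans_le (hzmax ⟨⟨hv2.1.le, hv2.2⟩, hv1.le⟩)
  have hmin : ∀ v ∈ Icc z ζ₂, g z τ₀ ≤ g v τ₀ := by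
    intro v hv
    rcases le_total ε v with h | h
    · exact hzx'.trans (hxmin ⟨h, hv.2⟩)
    · rcases hv.1.eq_or_lt with rfl | hlt
      · exact le_rfl
      · by_contra! hcon
        exact hlt.not_ge (hzmax ⟨⟨hz0.le.trans hv.1, h⟩, (hcon.le.trans hzx')⟩)
  have hGmin : ∀ v ∈ Icc z ζ₂, G μ K g τ₀ ζ₂ z ≤ G μ K g τ₀ ζ₂ v := fun v hv =>
    hGle hz0.le (hz0.le.trans hv.1) (hmin v hv)
  exact ⟨z, hz0, hz.2.trans_lt hεζ,
    fun v hv => ⟨(hlt z ⟨hz0, hz.2⟩).le.trans (hGmin v hv),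
      (hN.G_spec hK hg hC (hz0.le.trans hv.1)).1.2⟩,
    fun v hv => (hN.G_spec hK hg hC hv).1, hGmin, fun s hs => hlt s ⟨hs.1, hs.2.trans hz.2⟩⟩

/-! ### Dichotomy for bounded solutions -/

/-- The supremum `M` of a solution satisfies `Θ(M) ≤ C sup g(·, τ₀) < Θ(ζ₂)`. -/
theorem CondN.lt_zeta_of_isSolution (hK : IsKernel μ K) (hg : IsNonlinearity g)
    (hC : CondC μ K g) (hN : CondN μ K g τ₀ ζ₂) {φ : ℝ → ℝ} (hφ : IsSolution μ K g φ)
    (hbdd : BddAbove (range φ)) (hmono : StrictMonoOn (Theta μ K g τ₀) (Icc 0 (⨆ t, φ t))) :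
    ⨆ t, φ t < ζ₂ := by
  have hM : ∀ t, φ t ≤ ⨆ t, φ t := le_ciSup hbdd
  have hle : ⨆ t, φ t ≤ gTilde μ K g τ₀ (⨆ t, φ t) +
      (∫ s, K s τ₀) * sSup ((fun v => g v τ₀) '' Ici 0) := by
    refine ciSup_le fun t => ?_
    rw [hφ.eq_prod t]
    exact hN.le_gTilde_add hK hg hC (hφ.aemeasurable_sub t) le_rfl (fun s => hφ.nonneg _)
      (fun s => hM _) fun v hv => le_csSup hN.bdd ⟨v, hv.1, rfl⟩
  by_contra! hcon
  have h1 := hmono.monotoneOn ⟨hN.zeta_pos.le, hcon⟩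
    ⟨hN.zeta_pos.le.trans hcon, le_rfl⟩ hcon
  have h2 := hN.theta_gt
  rw [Theta] at h1 h2
  rw [Theta] at h1
  linarith

/-- A solution with values in `[0, ζ₂]` does not attain a minimum in `(0, ζ₁]`: at such a minimum
`m`, monotonicity in the components `τ ≠ τ₀` yields `Θ(m) ≥ C min g(·, τ₀)`, the minimum being
taken over `[m, ζ₂]`, that is, `m ≥ G(x)` for some `x ∈ [m, ζ₂]`; but `G > m` there. -/
theorem CondN.not_attains_min (hK : IsKernel μ K) (hg : IsNonlinearity g)
    (hC : CondC μ K g) (hN : CondN μ K g τ₀ ζ₂) (hζ : IsZeta1 μ K g τ₀ ζ₂ ζ₁) {ψ : ℝ → ℝ}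
    (hψ : IsSolution μ K g ψ) {t : ℝ} (hpos : 0 < ψ t) (hle : ψ t ≤ ζ₁)
    (hmin : ∀ s, ψ t ≤ ψ s) (hM : ∀ s, ψ s ≤ ζ₂) : False := by
  obtain ⟨x, hx, hxmin⟩ := isCompact_Icc.exists_isMinOn (nonempty_Icc.2 (hM t))
    ((hg.continuousOn τ₀).mono fun v (hv : v ∈ Icc (ψ t) ζ₂) => hpos.le.trans hv.1)
  have h1 := hN.gTilde_add_le hK hg hC (hψ.aemeasurable_sub t) hpos.le (fun s => hmin _)
    (fun s => hM _) fun v hv => hxmin hv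
  rw [← hψ.eq_prod t] at h1
  obtain ⟨hGmem, hGeq⟩ := hN.G_spec hK hg hC (hpos.le.trans hx.1)
  have h2 : G μ K g τ₀ ζ₂ x ≤ ψ t := by
    rw [← hN.theta_strictMono.le_iff_le hGmem ⟨hpos.le, hM t⟩, hGeq, Theta]
    linarith
  rcases le_total x ζ₁ with h | h
  · exact (h2.trans hx.1).not_gt (hζ.gt_self x ⟨hpos.trans_le hx.1, h⟩)
  · have h3 : G μ K g τ₀ ζ₂ ζ₁ ≤ G μ K g τ₀ ζ₂ x := hζ.min_eq ⟨h, hx.2⟩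
    exact (h3.trans (h2.trans hle)).not_gt (hζ.gt_self ζ₁ ⟨hζ.pos, le_rfl⟩)

/-- If the values of a solution along `t i` tend to an asymptotic lower bound `m > 0` of the
solution around the points `t i`, then `m` exceeds `ζ₁`. -/
theorem CondN.lt_of_tendsto_translates (hK : IsKernel μ K) (hg : IsNonlinearity g)
    (hC : CondC μ K g) (hN : CondN μ K g τ₀ ζ₂) (hζ : IsZeta1 μ K g τ₀ ζ₂ ζ₁) {φ : ℝ → ℝ}
    (hφ : IsSolution μ K g φ) (hM : ∀ s, φ s ≤ ζ₂) {m : ℝ} (hm : 0 < m) {t : ℕ → ℝ}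
    (ht : Tendsto (fun i => φ (t i)) atTop (𝓝 m))
    (hlow : ∀ s, ∀ a < m, ∀ᶠ i in atTop, a ≤ φ (t i + s)) : ζ₁ < m := by
  by_contra! hle
  obtain ⟨ψ, n, hn, hψc, hψM, hlim⟩ := exists_subseq_tendsto_translates
    (hφ.uniformContinuous hK hg hC hM) (fun x => ⟨hφ.nonneg x, hM x⟩) t
  have hψ := hφ.of_tendsto_translates (t := t ∘ n) hK hg hC hM hψc hlim
  have hψ0 : ψ 0 = m := by
    refine tendsto_nhds_unique (hlim 0) ?_
    simpa [Function.comp_def] using ht.comp hn.tendsto_atTop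
  have hψlow : ∀ s, m ≤ ψ s := fun s => le_of_forall_lt fun a ha => by
    obtain ⟨b, hab, hbm⟩ := exists_between ha
    exact hab.trans_le (ge_of_tendsto (hlim s) (hn.tendsto_atTop.eventually (hlow s b hbm)))
  exact hN.not_attains_min hK hg hC hζ hψ (t := 0) (hψ0 ▸ hm) (hψ0 ▸ hle)
    (fun s => hψ0 ▸ hψlow s) fun s => (hψM s).2

theorem CondN.lt_ciInf (hK : IsKernel μ K) (hg : IsNonlinearity g)
    (hC : CondC μ K g) (hN : CondN μ K g τ₀ ζ₂) (hζ : IsZeta1 μ K g τ₀ ζ₂ ζ₁) {φ : ℝ → ℝ}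
    (hφ : IsSolution μ K g φ) (hM : ∀ s, φ s ≤ ζ₂) (hm : 0 < ⨅ t, φ t) : ζ₁ < ⨅ t, φ t := by
  have hbdd : BddBelow (range φ) := ⟨0, by rintro _ ⟨t, rfl⟩; exact hφ.nonneg t⟩
  obtain ⟨u, -, hu, hmem⟩ := exists_seq_tendsto_sInf (range_nonempty φ) hbdd
  choose t ht using hmem
  exact hN.lt_of_tendsto_translates hK hg hC hζ hφ hM hm (t := t) (by simpa only [ht] using! hu)
    fun s a ha => Eventually.of_forall fun i => ha.le.trans (ciInf_le hbdd _)

theorem CondN.lt_liminf (hK : IsKernel μ K) (hg : IsNonlinearity g)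
    (hC : CondC μ K g) (hN : CondN μ K g τ₀ ζ₂) (hζ : IsZeta1 μ K g τ₀ ζ₂ ζ₁) {φ : ℝ → ℝ}
    (hφ : IsSolution μ K g φ) (hM : ∀ s, φ s ≤ ζ₂) {l : Filter ℝ} [l.NeBot]
    [l.IsCountablyGenerated] (hl : ∀ s, Tendsto (fun t => t + s) l l)
    (hm : 0 < liminf φ l) : ζ₁ < liminf φ l := by
  have hb : IsBoundedUnder (· ≥ ·) l φ := isBoundedUnder_of ⟨0, hφ.nonneg⟩
  have hcb : IsCoboundedUnder (· ≥ ·) l φ :=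
    (isBoundedUnder_of ⟨ζ₂, hM⟩ : IsBoundedUnder (· ≤ ·) l φ).isCoboundedUnder_ge
  have hcluster : MapClusterPt (liminf φ l) l φ := by
    rw [mapClusterPt_iff_frequently]
    intro s hs
    obtain ⟨r, hr, hball⟩ := Metric.mem_nhds_iff.1 hs
    have h1 := frequently_lt_of_liminf_lt hcb (show liminf φ l < liminf φ l + r by linarith)
    have h2 := eventually_lt_of_lt_liminf (show liminf φ l - r < liminf φ l by linarith) hb
    refine (h1.and_eventually h2).mono fun x hx => hball ?_
    rw [Metric.mem_ball, Real.dist_eq, abs_sub_lt_iff]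
    constructor <;> linarith [hx.1, hx.2]
  have hne : (l ⊓ comap φ (𝓝 (liminf φ l))).NeBot := by
    rw [← map_neBot_iff φ, Filter.push_pull, inf_comm]
    exact hcluster
  obtain ⟨t, ht⟩ := exists_seq_tendsto (l ⊓ comap φ (𝓝 (liminf φ l)))
  rw [tendsto_inf, tendsto_comap_iff] at ht
  exact hN.lt_of_tendsto_translates hK hg hC hζ hφ hM hm ht.2 fun s a ha =>
    ((hl s).comp ht.1).eventually ((eventually_lt_of_lt_liminf ha hb).mono fun _ h => h.le)

/-- A nonnegative function that does not tend to zero is frequently bounded away from it. -/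
theorem exists_frequently_le_of_not_tendsto {φ : ℝ → ℝ} (hφ : ∀ t, 0 ≤ φ t) {l : Filter ℝ}
    (h : ¬ Tendsto φ l (𝓝 0)) : ∃ ε > 0, ∃ᶠ t in l, ε ≤ φ t := by
  contrapose! h
  refine tendsto_order.2 ⟨fun a ha => Eventually.of_forall fun t => ha.trans_le (hφ t),
    fun a ha => ?_⟩
  simpa using h a ha

end ConvEq

theorem mainTheorem3 {X : Type*} [MeasurableSpace X] (μ : Measure X) [IsFiniteMeasure μ]
    (K g : ℝ → X → ℝ) (hK : ConvEq.IsKernel μ K) (hg : ConvEq.IsNonlinearity g)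
    (hC : ConvEq.CondC μ K g) (hP : ConvEq.CondP μ K g) (hchi : ConvEq.chi μ K g 0 < 0)
    (τ₀ : X) (ζ₂ : ℝ) (hN : ConvEq.CondN μ K g τ₀ ζ₂) :
    (∃ ζ₁ : ℝ, ConvEq.IsZeta1 μ K g τ₀ ζ₂ ζ₁) ∧
    ∀ ζ₁ : ℝ, ConvEq.IsZeta1 μ K g τ₀ ζ₂ ζ₁ →
      ∀ φ : ℝ → ℝ, ConvEq.IsSolution μ K g φ → (∀ t, 0 < φ t) → BddAbove (range φ) →
        StrictMonoOn (ConvEq.Theta μ K g τ₀) (Icc 0 (⨆ t, φ t)) →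
        (⨅ t, φ t) < ζ₁ →
          (Tendsto φ atTop (𝓝 0) ∧ ζ₁ < liminf φ atBot) ∨
          (Tendsto φ atBot (𝓝 0) ∧ ζ₁ < liminf φ atTop) := by
  refine ⟨hN.exists_isZeta1 hK hg hC hchi, fun ζ₁ hζ φ hφ hpos hbdd hmono hinf => ?_⟩
  have hM : ∀ t, φ t ≤ ζ₂ := fun t =>
    (le_ciSup hbdd t).trans (hN.lt_zeta_of_isSolution hK hg hC hφ hbdd hmono).le
  have hinf0 : ⨅ t, φ t = 0 := by
    refine le_antisymm ?_ (le_ciInf hφ.nonneg)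
    by_contra! hm
    exact hinf.not_gt (hN.lt_ciInf hK hg hC hζ hφ hM hm)
  have hsmall := fun {ε : ℝ} => hφ.exists_small_imp_or hK hg hC hP hchi hpos hM (ε := ε)
  have hboth := hφ.not_tendsto_zero_both hK hg hC hchi hpos hM
  have hfreq : ∀ {l : Filter ℝ} [l.NeBot], liminf φ l ≤ 0 → ∀ δ > 0, ∃ᶠ t in l, φ t < δ :=
    fun {l} _ h δ hδ => frequently_lt_of_liminf_lt
      (isBoundedUnder_of ⟨ζ₂, hM⟩ : IsBoundedUnder (· ≤ ·) l φ).isCoboundedUnder_ge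
      (h.trans_lt hδ)
  -- If small values recur at one end, then the solution vanishes at this end.
  have hbot : liminf φ atBot ≤ 0 → Tendsto φ atBot (𝓝 0) := by
    intro h
    by_contra hnot
    obtain ⟨ε, hε, hfε⟩ := ConvEq.exists_frequently_le_of_not_tendsto hφ.nonneg hnot
    obtain ⟨δ, hδ, hδ'⟩ := hsmall hε
    obtain ⟨b, hb, -⟩ := (hfε.and_eventually (eventually_le_atBot 0)).exists
    obtain ⟨c, hc, hcb⟩ := ((hfreq h δ hδ).and_eventually (eventually_le_atBot b)).exists
    obtain ⟨a, ha, hac⟩ := (hfε.and_eventually (eventually_le_atBot c)).exists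
    exact (hδ' a b c hac hcb hc).elim ha.not_gt hb.not_gt
  have htop : liminf φ atTop ≤ 0 → Tendsto φ atTop (𝓝 0) := by
    intro h
    by_contra hnot
    obtain ⟨ε, hε, hfε⟩ := ConvEq.exists_frequently_le_of_not_tendsto hφ.nonneg hnot
    obtain ⟨δ, hδ, hδ'⟩ := hsmall hε
    obtain ⟨a, ha, -⟩ := (hfε.and_eventually (eventually_ge_atTop 0)).exists
    obtain ⟨c, hc, hac⟩ := ((hfreq h δ hδ).and_eventually (eventually_ge_atTop a)).exists
    obtain ⟨b, hb, hcb⟩ := (hfε.and_eventually (eventually_ge_atTop c)).exists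
    exact (hδ' a b c hac hcb hc).elim ha.not_gt hb.not_gt
  have hor : Tendsto φ atTop (𝓝 0) ∨ Tendsto φ atBot (𝓝 0) := by
    by_contra! hnot
    obtain ⟨ε₁, hε₁, hf₁⟩ := ConvEq.exists_frequently_le_of_not_tendsto hφ.nonneg hnot.1
    obtain ⟨ε₂, hε₂, hf₂⟩ := ConvEq.exists_frequently_le_of_not_tendsto hφ.nonneg hnot.2
    obtain ⟨δ, hδ, hδ'⟩ := hsmall (lt_min hε₁ hε₂)
    obtain ⟨c, hc⟩ := exists_lt_of_ciInf_lt (hinf0.trans_lt hδ)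
    obtain ⟨b, hb, hcb⟩ := (hf₁.and_eventually (eventually_ge_atTop c)).exists
    obtain ⟨a, ha, hac⟩ := (hf₂.and_eventually (eventually_le_atBot c)).exists
    exact (hδ' a b c hac hcb hc).elim ((min_le_right _ _).trans ha).not_gt
      ((min_le_left _ _).trans hb).not_gt
  rcases hor with h | h
  · refine Or.inl ⟨h, hN.lt_liminf hK hg hC hζ hφ hM
      (fun s => tendsto_atBot_add_const_right _ s tendsto_id) ?_⟩
    by_contra! hle
    exact hboth (hbot hle) h
  · refine Or.inr ⟨h, hN.lt_liminf hK hg hC hζ hφ hM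
      (fun s => tendsto_atTop_add_const_right _ s tendsto_id) ?_⟩
    by_contra! hle
    exact hboth h (htop hle)
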